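/- All simplicial complexes are abstract simplicial complexes; a $k$-simplex (or $k$-face) has $k+1$ vertices. Let $d\ge 2$. A locally finite simplicial complex $\Sigma$ with all simplices of dimension at most $d$ is called a \emph{triangulated $d$-manifold} if it is a mod 2 homology manifold without boundary, that is, if for every $k$ the link of each $k$-simplex has the reduced $\mathbb{Z}_2$-homology of the sphere $S^{d-k-1}$ (with $S^{-1}=\emptyset$). In particular, every triangulation of a topological $d$-manifold without boundary is one. For a simplicial complex $\Sigma$, call a $(d-2)$-simplex \emph{odd} if it is contained in an odd number of $d$-simplices of $\Sigma$, and let the \emph{odd subcomplex} $\Sigma_{odd}$ consist of all odd $(d-2)$-simplices and their faces. \textbf{Theorem.} \begin{enumerate} \item Let $\Sigma$ be a finite triangulated $d$-manifold or, more generally, any finite simplicial complex in which every $(d-1)$-simplex is contained in an even number of $d$-simplices. Then the sum modulo $2$ of all $(d-2)$-simplices of $\Sigma_{odd}$ is a cycle, and it represents the zero element of $H_{d-2}(\Sigma;\mathbb{Z}_2)$. \item Let $\Sigma$ be any finite simplicial complex (for instance, a finite triangulated $d$-manifold). Let $\sharp(\Sigma_{odd})$ be the number of $(d-2)$-simplices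 of $\Sigma_{odd}$ and $\sharp(\Sigma)$ the number of $d$-simplices of $\Sigma$. If $d\equiv 0$ or $3 \pmod 4$, then $\sharp(\Sigma_{odd})$ is even. If $d\equiv 1$ or $2\pmod 4$, then $\sharp(\Sigma_{odd})\equiv\sharp(\Sigma)\pmod 2$. \item Let $d\ge 3$, let $\Sigma$ be a (possibly infinite) triangulated $d$-manifold, and let $\tau$ be a $(d-3)$-simplex of $\Sigma$ that is contained in exactly two odd $(d-2)$-simplices $\sigma_1\ne\sigma_2$. Then no $(d-1)$-simplex of $\Sigma$ contains both $\sigma_1$ and $\sigma_2$. \end{enumerate} -/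

import Mathlib

/-! Simplicial complexes are Mathlib's `PreAbstractSimplicialComplex V`: sets of nonempty finite
subsets of `V`, closed under taking nonempty subsets.  A simplex of dimension `k` has `k + 1`
vertices. -/

/-- The quotient `Z / B` (of `Z` by `Z ∩ B`) for submodules `Z` and `B` of a module. -/
abbrev Subquotient {R M : Type*} [Ring R] [AddCommGroup M] [Module R M] (Z B : Submodule R M) :
    Type _ :=
  Z ⧸ B.submoduleOf Z

section ModTwoHomology

variable {V : Type*} [DecidableEq V]

/-- Mod 2 chains on the members of cardinality `n` of a family `F` of finite sets. -/
def modTwoChains (F : Set (Finset V)) (n : ℕ) : Submodule (ZMod 2) (Finset V →₀ ZMod 2) :=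
  Finsupp.supported (ZMod 2) (ZMod 2) {s | s ∈ F ∧ s.card = n}

open Classical in
/-- The mod 2 boundary operator of a family `F` of finite sets: a set is sent to the sum of those
of its codimension-one faces that belong to `F`. -/
noncomputable def modTwoBoundary (F : Set (Finset V)) :
    (Finset V →₀ ZMod 2) →ₗ[ZMod 2] (Finset V →₀ ZMod 2) :=
  Finsupp.linearCombination (ZMod 2) fun s : Finset V =>
    ∑ v ∈ s with s.erase v ∈ F, Finsupp.single (s.erase v) (1 : ZMod 2)

/-- Chains on sets of cardinality `n` with vanishing boundary. -/
noncomputable def modTwoCycles (F : Set (Finset V)) (n : ℕ) :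
    Submodule (ZMod 2) (Finset V →₀ ZMod 2) :=
  modTwoChains F n ⊓ LinearMap.ker (modTwoBoundary F)

/-- Boundaries of chains on sets of cardinality `n + 1`. -/
noncomputable def modTwoBoundaries (F : Set (Finset V)) (n : ℕ) :
    Submodule (ZMod 2) (Finset V →₀ ZMod 2) :=
  (modTwoChains F (n + 1)).map (modTwoBoundary F)

/-- Cycles modulo boundaries, on sets of cardinality `n` (that is, in degree `n - 1`). -/
abbrev ModTwoHomology (F : Set (Finset V)) (n : ℕ) : Type _ :=
  Subquotient (modTwoCycles F n) (modTwoBoundaries F n)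

end ModTwoHomology

namespace PreAbstractSimplicialComplex

variable {V : Type*} [DecidableEq V]

/-- The set of `k`-dimensional simplices of `K`. -/
def simplices (K : PreAbstractSimplicialComplex V) (k : ℕ) : Set (Finset V) :=
  {s | s ∈ K ∧ s.card = k + 1}

/-- The group of simplicial `k`-cycles of `K` with coefficients in `ℤ/2`. -/
noncomputable abbrev cycles (K : PreAbstractSimplicialComplex V) (k : ℕ) :
    Submodule (ZMod 2) (Finset V →₀ ZMod 2) :=
  modTwoCycles K.faces (k + 1)

/-- The simplicial homology group `H_k(K; ℤ/2)` (not reduced). -/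
abbrev Homology (K : PreAbstractSimplicialComplex V) (k : ℕ) : Type _ :=
  ModTwoHomology K.faces (k + 1)

/-- The class in `H_k(K; ℤ/2)` of a cycle. -/
noncomputable def homologyClass (K : PreAbstractSimplicialComplex V) (k : ℕ) :
    K.cycles k →ₗ[ZMod 2] K.Homology k :=
  Submodule.mkQ _

/-- The reduced homology group of `K` with coefficients in `ℤ/2` in degree `n - 1`: the homology
of the augmented chain complex, in which the empty set is a simplex of dimension `-1`. -/
abbrev ReducedHomology (K : PreAbstractSimplicialComplex V) (n : ℕ) : Type _ :=
  ModTwoHomology (insert ∅ K.faces) n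

/-- `K` has the mod 2 homology of a sphere of dimension `n - 1`: its reduced homology is `ℤ/2` in
degree `n - 1` and zero in all other degrees.  The sphere of dimension `-1` is empty. -/
def IsModTwoHomologySphere (K : PreAbstractSimplicialComplex V) (n : ℕ) : Prop :=
  Nonempty (K.ReducedHomology n ≃ₗ[ZMod 2] ZMod 2) ∧
    ∀ j : ℕ, j ≠ n → Subsingleton (K.ReducedHomology j)

/-- The link of `s` in `K`. -/
def link (K : PreAbstractSimplicialComplex V) (s : Finset V) : PreAbstractSimplicialComplex V where
  faces := {t | t.Nonempty ∧ Disjoint s t ∧ s ∪ t ∈ K}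
  isRelLowerSet_faces := by
    rintro t ⟨hne, hd, hK⟩
    refine ⟨hne, fun u hu hune => ⟨hune, Finset.disjoint_of_subset_right hu hd, ?_⟩⟩
    exact (K.isRelLowerSet_faces hK).2 (Finset.union_subset_union_right hu)
      (hune.mono Finset.subset_union_right)

/-- `K` is a triangulated `d`-manifold without boundary, in the broad sense of a mod 2 homology
manifold (every triangulation of a topological `d`-manifold without boundary is one): it is locally finite, all simplices have dimension at most `d`, and the link of every simplex of
dimension `k` has the mod 2 homology of a sphere of dimension `d - k - 1`.  A simplex `s` has
dimension `s.card - 1`, so the sphere has dimension `(d + 1 - s.card) - 1`. -/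
structure IsHomologyManifold (K : PreAbstractSimplicialComplex V) (d : ℕ) : Prop where
  locallyFinite : ∀ s ∈ K, {t | t ∈ K ∧ s ⊆ t}.Finite
  card_le : ∀ s ∈ K, s.card ≤ d + 1
  link_sphere : ∀ s ∈ K, (K.link s).IsModTwoHomologySphere (d + 1 - s.card)

/-- The number of `k`-simplices of `K` that contain `s`. -/
noncomputable def incidence (K : PreAbstractSimplicialComplex V) (k : ℕ) (s : Finset V) : ℕ :=
  {t | t ∈ K.simplices k ∧ s ⊆ t}.ncard

/-- The odd subcomplex of a `d`-dimensional complex (`2 ≤ d`): the subcomplex formed by the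
`(d - 2)`-simplices that lie in an odd number of `d`-simplices, together with their faces. -/
def oddSubcomplex (K : PreAbstractSimplicialComplex V) (d : ℕ) :
    PreAbstractSimplicialComplex V where
  faces := {t | t.Nonempty ∧ ∃ s ∈ K.simplices (d - 2), Odd (K.incidence d s) ∧ t ⊆ s}
  isRelLowerSet_faces := by
    rintro t ⟨hne, s, hs, ho, hts⟩
    exact ⟨hne, fun u hu hune => ⟨hune, s, hs, ho, hu.trans hts⟩⟩

/-- The mod 2 sum of all `k`-simplices of a finite complex. -/
noncomputable def fundamentalChain (K : PreAbstractSimplicialComplex V) (k : ℕ) :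
    Finset V →₀ ZMod 2 :=
  ∑ᶠ s ∈ K.simplices k, Finsupp.single s 1

/-- The mod 2 sum of all `(d - 2)`-simplices of the odd subcomplex of `K` is a cycle, and its class
in `H_{d-2}(K; ℤ/2)` is zero. -/
def OddClassVanishes (K : PreAbstractSimplicialComplex V) (d : ℕ) : Prop :=
  ∃ h : (K.oddSubcomplex d).fundamentalChain (d - 2) ∈ K.cycles (d - 2),
    K.homologyClass (d - 2) ⟨_, h⟩ = 0

end PreAbstractSimplicialComplex

/-!
Fix a total order of the vertices, and let `E` send a simplex to the sum of its facets opposite to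
the vertices of odd rank. The signs of the integral boundary are `(-1) ^ rank`, so `∂ ∘ ∂ = 0` over
`ℤ` says that modulo 2 the operator `∂ ∘ E + E ∘ ∂` sends every simplex to the sum of all its faces
of codimension two. Applied to the cycle `z` formed by all `d`-simplices, this exhibits the sum of
the odd `(d - 2)`-simplices as the boundary of `E z`. The parity statement comes from counting the
incidences between `d`-simplices and `(d - 2)`-simplices, of which each `d`-simplex has
`(d + 1).choose 2`.

For the last part, the link of `τ` is a closed surface in which exactly two vertices are odd.
Suppose that they span an edge `e`. Since a vertex lies on as many edges as triangles, the edges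
other than `e` form a cycle, which therefore bounds a set of triangles. With `T` the number of
triangles, `E` the number of edges and `B` the size of this set, `3 * T = 2 * E` and
`3 * B = E - 1` or `3 * B = E + 1`, which is impossible modulo 3.
-/

namespace ModTwoHomology

section Chains

variable {α V : Type*}

theorem eq_sum_support_single (x : α →₀ ZMod 2) : x = ∑ a ∈ x.support, Finsupp.single a 1 := by
  conv_lhs => rw [← Finsupp.sum_single x]
  refine Finset.sum_congr rfl fun a ha => ?_
  have hxa : x a = 1 := Fin.eq_one_of_ne_zero (x a) (Finsupp.mem_support_iff.1 ha)
  rw [hxa]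

theorem linearMap_apply_eq_card (L : (α →₀ ZMod 2) →ₗ[ZMod 2] (α →₀ ZMod 2)) {b : α}
    {p : α → Prop} [DecidablePred p] {x : α →₀ ZMod 2}
    (hL : ∀ a ∈ x.support, L (Finsupp.single a 1) b = if p a then 1 else 0) :
    L x b = (({a ∈ x.support | p a} : Finset α).card : ZMod 2) := by
  conv_lhs => rw [eq_sum_support_single x]
  rw [map_sum, Finsupp.finsetSum_apply, Finset.sum_congr rfl hL, Finset.sum_boole]

theorem modTwoChains_mono {F G : Set (Finset V)} {n : ℕ}
    (h : ∀ s ∈ F, s.card = n → s ∈ G) : modTwoChains F n ≤ modTwoChains G n :=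
  Finsupp.supported_mono fun s hs => ⟨h s hs.1 hs.2, hs.2⟩

end Chains

section WeightedBoundary

variable {V : Type*} [DecidableEq V]

/-- The linear operator on mod 2 chains which sends a set `s` to the sum of its codimension-one
faces, the face `s.erase v` being taken with coefficient `g s v`. The boundary operator
`modTwoBoundary F` is the case in which `g s v` indicates that `s.erase v` belongs to `F`. -/
noncomputable def weightedBoundary (g : Finset V → V → ZMod 2) :
    (Finset V →₀ ZMod 2) →ₗ[ZMod 2] (Finset V →₀ ZMod 2) :=
  Finsupp.linearCombination (ZMod 2) fun s => ∑ v ∈ s, g s v • Finsupp.single (s.erase v) 1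

variable (g h : Finset V → V → ZMod 2)

theorem weightedBoundary_single (s : Finset V) :
    weightedBoundary g (Finsupp.single s 1) =
      ∑ v ∈ s, g s v • Finsupp.single (s.erase v) 1 := by
  rw [weightedBoundary, Finsupp.linearCombination_single, one_smul]

open Classical in
theorem modTwoBoundary_eq_weightedBoundary (F : Set (Finset V)) :
    modTwoBoundary F = weightedBoundary fun s v => if s.erase v ∈ F then 1 else 0 := by
  simp only [modTwoBoundary, weightedBoundary, Finset.sum_filter, ite_smul, one_smul, zero_smul]

theorem weightedBoundary_single_insert_apply {a : V} {t : Finset V} (ha : a ∉ t) :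
    weightedBoundary g (Finsupp.single (insert a t) 1) t = g (insert a t) a := by
  rw [weightedBoundary_single, Finsupp.finsetSum_apply,
    Finset.sum_eq_single_of_mem a (Finset.mem_insert_self a t)]
  · simp [Finset.erase_insert ha]
  · intro v _ hva
    have hne : (insert a t).erase v ≠ t := fun h =>
      ha (h ▸ Finset.mem_erase.2 ⟨hva.symm, Finset.mem_insert_self a t⟩)
    simp [hne]

theorem weightedBoundary_single_apply_eq_zero {s t : Finset V}
    (hst : ¬(t ⊆ s ∧ t.card + 1 = s.card)) :
    weightedBoundary g (Finsupp.single s 1) t = 0 := by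
  rw [weightedBoundary_single, Finsupp.finsetSum_apply]
  refine Finset.sum_eq_zero fun v hv => ?_
  have hne : s.erase v ≠ t := by
    rintro rfl
    exact hst ⟨Finset.erase_subset v s, Finset.card_erase_add_one hv⟩
  simp [hne]

theorem weightedBoundary_mem_modTwoChains {F : Set (Finset V)} {n : ℕ}
    (hF : ∀ s ∈ F, s.card = n + 1 → ∀ v ∈ s, s.erase v ∈ F) {x : Finset V →₀ ZMod 2}
    (hx : x ∈ modTwoChains F (n + 1)) : weightedBoundary g x ∈ modTwoChains F n := by
  rw [eq_sum_support_single x, map_sum]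
  refine Submodule.sum_mem _ fun s hs => ?_
  obtain ⟨hsF, hsc⟩ := (Finsupp.mem_supported _ _).1 hx hs
  rw [weightedBoundary_single]
  refine Submodule.sum_mem _ fun v hv => Submodule.smul_mem _ _ ?_
  refine Finsupp.single_mem_supported _ _ ⟨hF s hsF hsc v hv, ?_⟩
  rw [Finset.card_erase_of_mem hv, hsc, Nat.add_sub_cancel]

theorem weightedBoundary_comp_single_apply (s t : Finset V) :
    weightedBoundary h (weightedBoundary g (Finsupp.single s 1)) t =
      ∑ v ∈ s, g s v * weightedBoundary h (Finsupp.single (s.erase v) 1) t := by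
  simp only [weightedBoundary_single g, map_sum, map_smul, Finsupp.finsetSum_apply,
    Finsupp.smul_apply, smul_eq_mul]

theorem weightedBoundary_comp_single_insert_insert_apply {a b : V} {t : Finset V} (hab : a ≠ b)
    (ha : a ∉ t) (hb : b ∉ t) :
    weightedBoundary h (weightedBoundary g (Finsupp.single (insert a (insert b t)) 1)) t =
      g (insert a (insert b t)) a * h (insert b t) b +
        g (insert a (insert b t)) b * h (insert a t) a := by
  have ha' : a ∉ insert b t := by simp [hab, ha]
  have hdel_a : (insert a (insert b t)).erase a = insert b t := Finset.erase_insert ha'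
  have hdel_b : (insert a (insert b t)).erase b = insert a t := by
    rw [Finset.insert_comm, Finset.erase_insert (by simp [hab.symm, hb])]
  rw [weightedBoundary_comp_single_apply, Finset.sum_insert ha', Finset.sum_insert hb,
    hdel_a, hdel_b, weightedBoundary_single_insert_apply h hb,
    weightedBoundary_single_insert_apply h ha, Finset.sum_eq_zero, add_zero]
  intro v hv
  rw [weightedBoundary_single_apply_eq_zero, mul_zero]
  exact fun hsub => Finset.notMem_erase v _ (hsub.1 hv)

theorem weightedBoundary_comp_single_apply_eq_zero {s t : Finset V}
    (hst : ¬(t ⊆ s ∧ t.card + 2 = s.card)) :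
    weightedBoundary h (weightedBoundary g (Finsupp.single s 1)) t = 0 := by
  rw [weightedBoundary_comp_single_apply]
  refine Finset.sum_eq_zero fun v hv => ?_
  rw [weightedBoundary_single_apply_eq_zero, mul_zero]
  rintro ⟨hsub, hcard⟩
  have := Finset.card_erase_add_one hv
  exact hst ⟨hsub.trans (Finset.erase_subset v s), by omega⟩

theorem exists_eq_insert_insert {s t : Finset V} (hts : t ⊆ s) (hcard : t.card + 2 = s.card) :
    ∃ a b, a ≠ b ∧ a ∉ t ∧ b ∉ t ∧ s = insert a (insert b t) := by
  have hsdiff : (s \ t).card = 2 := by rw [Finset.card_sdiff_of_subset hts]; omega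
  obtain ⟨a, b, hab, hst⟩ := Finset.card_eq_two.1 hsdiff
  have ha : a ∈ s \ t := by simp [hst]
  have hb : b ∈ s \ t := by simp [hst]
  refine ⟨a, b, hab, (Finset.mem_sdiff.1 ha).2, (Finset.mem_sdiff.1 hb).2, ?_⟩
  rw [← Finset.sdiff_union_of_subset hts, hst, Finset.insert_union, ← Finset.insert_eq]

end WeightedBoundary

section Boundary

variable {V : Type*} [DecidableEq V] {F : Set (Finset V)}

open Classical in
theorem modTwoBoundary_single_apply (s t : Finset V) :
    modTwoBoundary F (Finsupp.single s 1) t =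
      if t ∈ F ∧ t ⊆ s ∧ t.card + 1 = s.card then 1 else 0 := by
  rw [modTwoBoundary_eq_weightedBoundary]
  by_cases hface : t ⊆ s ∧ t.card + 1 = s.card
  · obtain ⟨a, ha, rfl⟩ := Finset.exists_eq_insert_iff.2 hface
    rw [weightedBoundary_single_insert_apply _ ha, Finset.erase_insert ha]
    simp [hface]
  · rw [weightedBoundary_single_apply_eq_zero _ hface, if_neg fun h => hface h.2]

open Classical in
theorem modTwoBoundary_apply {G : Set (Finset V)} {n : ℕ} {x : Finset V →₀ ZMod 2}
    (hx : x ∈ modTwoChains G (n + 1)) (t : Finset V) :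
    modTwoBoundary F x t =
      if t ∈ F ∧ t.card = n then (({s ∈ x.support | t ⊆ s} : Finset (Finset V)).card : ZMod 2)
      else 0 := by
  have hcard : ∀ s ∈ x.support, s.card = n + 1 := fun s hs =>
    ((Finsupp.mem_supported _ _).1 hx hs).2
  rw [linearMap_apply_eq_card _ fun s _ => modTwoBoundary_single_apply s t]
  split_ifs with ht
  · congr 2
    refine Finset.filter_congr fun s hs => ?_
    simp [ht, hcard s hs]
  · rw [Finset.filter_false_of_mem, Finset.card_empty, Nat.cast_zero]
    rintro s hs ⟨htF, -, htc⟩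
    exact ht ⟨htF, by have := hcard s hs; omega⟩

theorem modTwoBoundary_modTwoBoundary {x : Finset V →₀ ZMod 2}
    (hx : ∀ s ∈ x.support, ∀ v ∈ s, s.erase v ∈ F) :
    modTwoBoundary F (modTwoBoundary F x) = 0 := by
  classical
  rw [eq_sum_support_single x, map_sum, map_sum]
  refine Finset.sum_eq_zero fun s hs => Finsupp.ext fun t => ?_
  rw [modTwoBoundary_eq_weightedBoundary]
  by_cases hst : t ⊆ s ∧ t.card + 2 = s.card
  · obtain ⟨a, b, hab, ha, hb, rfl⟩ := exists_eq_insert_insert hst.1 hst.2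
    rw [weightedBoundary_comp_single_insert_insert_apply _ _ hab ha hb,
      if_pos (hx _ hs a (by simp)), if_pos (hx _ hs b (by simp)), Finset.erase_insert ha,
      Finset.erase_insert hb, CharTwo.add_self_eq_zero, Finsupp.zero_apply]
  · exact weightedBoundary_comp_single_apply_eq_zero _ _ hst

open Classical in
/-- The parity of the rank of `v` in `s`, that is, of the number of members of `s` that precede
`v` in the order `r`. The integral simplicial boundary has the sign `(-1) ^ rankParity r s v` at
the face `s.erase v`. -/
noncomputable def rankParity (r : V → V → Prop) (s : Finset V) (v : V) : ZMod 2 :=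
  ({u ∈ s | r u v} : Finset V).card

open Classical in
theorem rankParity_insert (r : V → V → Prop) {a : V} {s : Finset V} (ha : a ∉ s) (v : V) :
    rankParity r (insert a s) v = rankParity r s v + if r a v then 1 else 0 := by
  rw [rankParity, rankParity, Finset.filter_insert]
  split_ifs
  · rw [Finset.card_insert_of_notMem (by simp [ha]), Nat.cast_succ]
  · rw [add_zero]

/-- This is the identity `∂ ∘ ∂ = 0` of the integral boundary, read off the signs of the two ways
to delete `a` and `b`. -/
theorem rankParity_add_eq_one (r : V → V → Prop) [IsStrictTotalOrder V r] {a b : V} {t : Finset V}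
    (hab : a ≠ b) (ha : a ∉ t) (hb : b ∉ t) :
    rankParity r (insert a (insert b t)) a + rankParity r (insert b t) b +
      (rankParity r (insert a (insert b t)) b + rankParity r (insert a t) a) = 1 := by
  classical
  have ha' : a ∉ insert b t := by simp [hab, ha]
  have hxor : (if r a b then (1 : ZMod 2) else 0) + (if r b a then 1 else 0) = 1 := by
    rcases trichotomous_of r a b with h | h | h
    · simp [h, asymm_of r h]
    · exact absurd h hab
    · simp [h, asymm_of r h]
  simp only [rankParity_insert r ha', rankParity_insert r hb, rankParity_insert r ha,
    irrefl_of r, if_false, add_zero]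
  linear_combination hxor + CharTwo.add_self_eq_zero (rankParity r t a) +
    CharTwo.add_self_eq_zero (rankParity r t b)

/-- Modulo 2, the operator that sums up all faces of codimension two is null-homotopic, with the
faces of odd rank as the homotopy. -/
theorem modTwoBoundary_weightedBoundary_rankParity_add_apply (r : V → V → Prop)
    [IsStrictTotalOrder V r] {x : Finset V →₀ ZMod 2} {t : Finset V}
    (hx : ∀ s ∈ x.support, ∀ v ∈ s, s.erase v ∈ F) (ht : t ∈ F) :
    modTwoBoundary F (weightedBoundary (rankParity r) x) t +
        weightedBoundary (rankParity r) (modTwoBoundary F x) t =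
      (({s ∈ x.support | t ⊆ s ∧ t.card + 2 = s.card} : Finset (Finset V)).card : ZMod 2) := by
  classical
  refine linearMap_apply_eq_card (modTwoBoundary F ∘ₗ weightedBoundary (rankParity r) +
    weightedBoundary (rankParity r) ∘ₗ modTwoBoundary F) fun s hs => ?_
  rw [modTwoBoundary_eq_weightedBoundary, LinearMap.add_apply, LinearMap.comp_apply,
    LinearMap.comp_apply, Finsupp.add_apply]
  split_ifs with hst
  · obtain ⟨a, b, hab, ha, hb, rfl⟩ := exists_eq_insert_insert hst.1 hst.2
    rw [weightedBoundary_comp_single_insert_insert_apply _ _ hab ha hb,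
      weightedBoundary_comp_single_insert_insert_apply _ _ hab ha hb,
      if_pos (hx _ hs a (by simp)), if_pos (hx _ hs b (by simp)), Finset.erase_insert ha,
      Finset.erase_insert hb, if_pos ht]
    linear_combination rankParity_add_eq_one r hab ha hb
  · rw [weightedBoundary_comp_single_apply_eq_zero _ _ hst,
      weightedBoundary_comp_single_apply_eq_zero _ _ hst, add_zero]

end Boundary

section Simplices

variable {V : Type*} {K : PreAbstractSimplicialComplex V} {k d : ℕ} {s t : Finset V}

theorem nonempty_of_mem (hs : s ∈ K) : s.Nonempty :=
  K.isRelLowerSet_faces.prop_of_mem hs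

theorem mem_of_subset (hs : s ∈ K) (hts : t ⊆ s) (ht : t.Nonempty) : t ∈ K :=
  K.isRelLowerSet_faces.mem_of_le hs hts ht

theorem mem_of_subset_of_card (hs : s ∈ K) (hts : t ⊆ s) (ht : t.card = k + 1) : t ∈ K :=
  mem_of_subset hs hts (Finset.card_pos.1 (by omega))

theorem mem_insert_empty_faces_and_card_iff :
    t ∈ insert ∅ K.faces ∧ t.card = k + 1 ↔ t ∈ K.simplices k := by
  constructor
  · rintro ⟨rfl | hmem, hcard⟩
    · simp at hcard
    · exact ⟨hmem, hcard⟩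
  · exact fun ht => ⟨Or.inr ht.1, ht.2⟩

theorem erase_mem_faces [DecidableEq V] (hs : s ∈ K) (hcard : s.card = k + 2) {v : V}
    (hv : v ∈ s) : s.erase v ∈ K.faces :=
  mem_of_subset_of_card hs (Finset.erase_subset v s)
    (by rw [Finset.card_erase_of_mem hv, hcard]; rfl : (s.erase v).card = k + 1)

theorem finite_simplices (hK : K.faces.Finite) (k : ℕ) : (K.simplices k).Finite :=
  hK.subset fun _ hs => hs.1

theorem simplices_oddSubcomplex :
    (K.oddSubcomplex d).simplices (d - 2) = {s ∈ K.simplices (d - 2) | Odd (K.incidence d s)} := by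
  ext s
  constructor
  · rintro ⟨⟨-, t, ht, hodd, hst⟩, hcard⟩
    obtain rfl := Finset.eq_of_subset_of_card_le hst (by rw [ht.2, hcard])
    exact ⟨ht, hodd⟩
  · rintro ⟨hs, hodd⟩
    exact ⟨⟨nonempty_of_mem hs.1, s, hs, hodd, subset_rfl⟩, hs.2⟩

theorem fundamentalChain_mem_modTwoChains (k : ℕ) :
    K.fundamentalChain k ∈ modTwoChains K.faces (k + 1) :=
  finsum_mem_induction (· ∈ modTwoChains K.faces (k + 1)) (zero_mem _) (fun _ _ => add_mem)
    fun _ hs => Finsupp.single_mem_supported _ _ hs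

open Classical in
theorem fundamentalChain_apply (hK : (K.simplices k).Finite) (s : Finset V) :
    K.fundamentalChain k s = if s ∈ K.simplices k then 1 else 0 := by
  rw [PreAbstractSimplicialComplex.fundamentalChain, finsum_mem_eq_finite_toFinset_sum _ hK]
  simp [Finsupp.finsetSum_apply, Finsupp.single_apply]

theorem support_fundamentalChain (hK : (K.simplices k).Finite) :
    (K.fundamentalChain k).support = hK.toFinset := by
  ext s
  simp [fundamentalChain_apply hK]

variable [DecidableEq V]

theorem incidence_eq_card (hK : (K.simplices k).Finite) (t : Finset V) :
    K.incidence k t = ({s ∈ hK.toFinset | t ⊆ s} : Finset (Finset V)).card := by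
  rw [PreAbstractSimplicialComplex.incidence, ← Set.ncard_coe_finset, Finset.coe_filter]
  simp only [hK.mem_toFinset]

open Classical in
theorem modTwoBoundary_fundamentalChain_apply {F : Set (Finset V)}
    (hK : (K.simplices k).Finite) (t : Finset V) :
    modTwoBoundary F (K.fundamentalChain k) t =
      if t ∈ F ∧ t.card = k then (K.incidence k t : ZMod 2) else 0 := by
  rw [modTwoBoundary_apply (fundamentalChain_mem_modTwoChains k), support_fundamentalChain hK,
    incidence_eq_card hK]

end Simplices

section OddChain

variable {V : Type*} {K : PreAbstractSimplicialComplex V} {d : ℕ}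

theorem finite_simplices_oddSubcomplex (hK : (K.simplices d).Finite) :
    ((K.oddSubcomplex d).simplices (d - 2)).Finite := by
  classical
  refine (hK.toFinset.biUnion Finset.powerset).finite_toSet.subset fun s hs => ?_
  rw [simplices_oddSubcomplex] at hs
  have hodd := hs.2
  rw [incidence_eq_card hK] at hodd
  obtain ⟨t, ht⟩ := Finset.card_pos.1 hodd.pos
  obtain ⟨htK, hst⟩ := Finset.mem_filter.1 ht
  exact Finset.mem_coe.2 (Finset.mem_biUnion.2 ⟨t, htK, Finset.mem_powerset.2 hst⟩)

open Classical in
theorem fundamentalChain_oddSubcomplex_apply (hK : (K.simplices d).Finite) (s : Finset V) :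
    (K.oddSubcomplex d).fundamentalChain (d - 2) s =
      if s ∈ K.simplices (d - 2) then (K.incidence d s : ZMod 2) else 0 := by
  rw [fundamentalChain_apply (finite_simplices_oddSubcomplex hK), simplices_oddSubcomplex]
  by_cases hs : s ∈ K.simplices (d - 2)
  · by_cases hodd : Odd (K.incidence d s)
    · rw [if_pos ⟨hs, hodd⟩, if_pos hs, ZMod.natCast_eq_one_iff_odd.2 hodd]
    · rw [if_neg fun h => hodd h.2, if_pos hs,
        ZMod.natCast_eq_zero_iff_even.2 (Nat.not_odd_iff_even.1 hodd)]
  · rw [if_neg fun h => hs h.1, if_neg hs]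

variable [DecidableEq V]

theorem modTwoBoundary_fundamentalChain_eq_zero (hK : (K.simplices (d + 1)).Finite)
    (heven : ∀ r ∈ K.simplices d, Even (K.incidence (d + 1) r)) :
    modTwoBoundary K.faces (K.fundamentalChain (d + 1)) = 0 := by
  classical
  ext t
  rw [modTwoBoundary_fundamentalChain_apply hK, Finsupp.zero_apply]
  split_ifs with ht
  · exact ZMod.natCast_eq_zero_iff_even.2 (heven t ht)
  · rfl

theorem fundamentalChain_oddSubcomplex_eq_modTwoBoundary (r : V → V → Prop)
    [IsStrictTotalOrder V r] (hK : (K.simplices (d + 2)).Finite)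
    (hcycle : modTwoBoundary K.faces (K.fundamentalChain (d + 2)) = 0) :
    (K.oddSubcomplex (d + 2)).fundamentalChain d =
      modTwoBoundary K.faces
        (weightedBoundary (rankParity r) (K.fundamentalChain (d + 2))) := by
  classical
  have hmem : ∀ s ∈ hK.toFinset, s ∈ K.simplices (d + 2) := fun s => hK.mem_toFinset.1
  have hchain : weightedBoundary (rankParity r) (K.fundamentalChain (d + 2)) ∈
      modTwoChains K.faces (d + 2) :=
    weightedBoundary_mem_modTwoChains _ (fun s hs hcard v => erase_mem_faces hs hcard)
      (fundamentalChain_mem_modTwoChains _)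
  ext t
  have hodd : (K.oddSubcomplex (d + 2)).fundamentalChain d t =
      if t ∈ K.simplices d then (K.incidence (d + 2) t : ZMod 2) else 0 :=
    fundamentalChain_oddSubcomplex_apply hK t
  rw [hodd, modTwoBoundary_apply hchain]
  refine if_ctx_congr Iff.rfl (fun ht => ?_) fun _ => rfl
  have hhomotopy := modTwoBoundary_weightedBoundary_rankParity_add_apply r (F := K.faces)
    (x := K.fundamentalChain (d + 2)) (fun s hs v => ?_) ht.1
  · rw [hcycle, map_zero, Finsupp.zero_apply, add_zero, support_fundamentalChain hK,
      Finset.filter_congr (q := (t ⊆ ·)) fun s hs => ?_, ← incidence_eq_card hK,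
      modTwoBoundary_apply hchain, if_pos ht] at hhomotopy
    · exact hhomotopy.symm
    · simp [ht.2, (hmem s hs).2]
  · rw [support_fundamentalChain hK] at hs
    exact erase_mem_faces (hmem s hs).1 (hmem s hs).2

theorem oddClassVanishes_of_forall_even (hd : 2 ≤ d) (hK : (K.simplices d).Finite)
    (heven : ∀ r ∈ K.simplices (d - 1), Even (K.incidence d r)) : K.OddClassVanishes d := by
  obtain ⟨n, rfl⟩ := Nat.exists_eq_add_of_le' hd
  have hodd := fundamentalChain_oddSubcomplex_eq_modTwoBoundary WellOrderingRel hK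
    (modTwoBoundary_fundamentalChain_eq_zero hK heven)
  set c := weightedBoundary (rankParity WellOrderingRel) (K.fundamentalChain (n + 2))
  have hc : c ∈ modTwoChains K.faces (n + 2) :=
    weightedBoundary_mem_modTwoChains _ (fun s hs hcard v => erase_mem_faces hs hcard)
      (fundamentalChain_mem_modTwoChains _)
  have hfacets : ∀ s ∈ c.support, ∀ v ∈ s, s.erase v ∈ K.faces := fun s hs v =>
    have hs' := (Finsupp.mem_supported _ _).1 hc hs
    erase_mem_faces hs'.1 hs'.2
  have hchain : modTwoBoundary K.faces c ∈ modTwoChains K.faces (n + 1) := by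
    rw [← hodd]
    exact modTwoChains_mono (fun s hs hcard => ((simplices_oddSubcomplex (d := n + 2)).subset
      ⟨hs, hcard⟩).1.1) (fundamentalChain_mem_modTwoChains n)
  refine ⟨?_, (Submodule.Quotient.mk_eq_zero _).2 ⟨c, hc, hodd.symm⟩⟩
  change (K.oddSubcomplex (n + 2)).fundamentalChain n ∈ _
  rw [hodd]
  exact ⟨hchain, modTwoBoundary_modTwoBoundary hfacets⟩

end OddChain

section Parity

variable {V : Type*}

theorem sum_card_filter_subset [DecidableEq V] {E B : Finset (Finset V)} {m n : ℕ}
    (hE : ∀ e ∈ E, e.card = m) (hB : ∀ t ∈ B, t.card = n) (hBE : ∀ t ∈ B, t.powersetCard m ⊆ E) :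
    ∑ e ∈ E, ({t ∈ B | e ⊆ t} : Finset (Finset V)).card = B.card * n.choose m := by
  have hfaces : ∀ t ∈ B, {e ∈ E | e ⊆ t} = t.powersetCard m := by
    intro t ht
    ext e
    rw [Finset.mem_filter, Finset.mem_powersetCard]
    exact ⟨fun he => ⟨he.2, hE e he.1⟩, fun he => ⟨hBE t ht (Finset.mem_powersetCard.2 he), he.1⟩⟩
  have hdouble := Finset.sum_card_bipartiteAbove_eq_sum_card_bipartiteBelow (s := E) (t := B)
    (· ⊆ ·)
  simp only [Finset.bipartiteAbove, Finset.bipartiteBelow] at hdouble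
  rw [hdouble]
  refine Finset.sum_const_nat fun t ht => ?_
  rw [hfaces t ht, Finset.card_powersetCard, hB t ht]

theorem ncard_odd_incidence_modEq {K : PreAbstractSimplicialComplex V} {k l : ℕ}
    (hK : (K.simplices l).Finite) :
    {s ∈ K.simplices k | Odd (K.incidence l s)}.ncard ≡
      (K.simplices l).ncard * (l + 1).choose (k + 1) [MOD 2] := by
  classical
  set S := hK.toFinset
  set E := S.biUnion (Finset.powersetCard (k + 1)) with hE
  have hmem : ∀ s ∈ S, s ∈ K.simplices l := fun s => hK.mem_toFinset.1
  have hodd : {s ∈ K.simplices k | Odd (K.incidence l s)} =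
      ({e ∈ E | Odd ({s ∈ S | e ⊆ s} : Finset (Finset V)).card} : Finset (Finset V)) := by
    ext e
    simp only [incidence_eq_card hK, Set.mem_ofPred_eq, Finset.coe_filter, hE, Finset.mem_biUnion,
      Finset.mem_powersetCard]
    refine and_congr_left fun h => ⟨fun he => ?_, ?_⟩
    · obtain ⟨s, hs⟩ := Finset.card_pos.1 h.pos
      exact ⟨s, (Finset.mem_filter.1 hs).1, (Finset.mem_filter.1 hs).2, he.2⟩
    · rintro ⟨s, hs, hes, hcard⟩
      exact ⟨mem_of_subset_of_card (hmem s hs).1 hes hcard, hcard⟩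
  rw [hodd, Set.ncard_coe_finset, Set.ncard_eq_toFinset_card _ hK, ← sum_card_filter_subset
    (E := E) (fun e he => ?_) (fun s hs => (hmem s hs).2) (fun s hs =>
    Finset.subset_biUnion_of_mem (Finset.powersetCard (k + 1)) hs)]
  · have := Finset.odd_sum_iff_odd_card_odd (s := E)
      fun e => ({s ∈ S | e ⊆ s} : Finset (Finset V)).card
    rw [Nat.ModEq]
    grind
  · obtain ⟨s, -, hes⟩ := Finset.mem_biUnion.1 he
    exact (Finset.mem_powersetCard.1 hes).2

theorem ncard_simplices_oddSubcomplex_modEq {K : PreAbstractSimplicialComplex V} {d : ℕ}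
    (hd : 2 ≤ d) (hK : (K.simplices d).Finite) :
    ((K.oddSubcomplex d).simplices (d - 2)).ncard ≡
      (K.simplices d).ncard * (d + 1).choose 2 [MOD 2] := by
  rw [simplices_oddSubcomplex, Nat.choose_symm_of_eq_add (show d + 1 = 2 + (d - 2 + 1) by omega)]
  exact ncard_odd_incidence_modEq hK

theorem even_choose_two_iff (n : ℕ) : Even (n.choose 2) ↔ n % 4 = 0 ∨ n % 4 = 1 := by
  induction n with
  | zero => simp
  | succ n ih =>
    rw [Nat.choose_succ_succ', Nat.choose_one_right, Nat.even_add, ih, Nat.even_iff]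
    omega

theorem ncard_simplices_oddSubcomplex_parity {K : PreAbstractSimplicialComplex V} {d : ℕ}
    (hd : 2 ≤ d) (hK : (K.simplices d).Finite) :
    (d % 4 = 0 ∨ d % 4 = 3 → Even ((K.oddSubcomplex d).simplices (d - 2)).ncard) ∧
      (d % 4 = 1 ∨ d % 4 = 2 →
        ((K.oddSubcomplex d).simplices (d - 2)).ncard ≡ (K.simplices d).ncard [MOD 2]) := by
  have hmod := ncard_simplices_oddSubcomplex_modEq hd hK
  have hchoose := even_choose_two_iff (d + 1)
  constructor <;> intro h
  · rw [Nat.even_iff, hmod, ← Nat.even_iff]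
    exact (hchoose.2 (by omega)).mul_left _
  · have hone : (d + 1).choose 2 ≡ 1 [MOD 2] :=
      Nat.odd_iff.1 (Nat.not_even_iff_odd.1 fun heven => by have := hchoose.1 heven; omega)
    exact hmod.trans (by simpa using hone.mul_left (K.simplices d).ncard)

end Parity

section Link

variable {V : Type*} [DecidableEq V] {K : PreAbstractSimplicialComplex V} {k : ℕ} {s t : Finset V}

theorem mem_simplices_link :
    t ∈ (K.link s).simplices k ↔ Disjoint s t ∧ s ∪ t ∈ K.simplices (k + s.card) := by
  constructor
  · rintro ⟨⟨-, hst, hmem⟩, hcard⟩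
    exact ⟨hst, hmem, by rw [Finset.card_union_of_disjoint hst]; omega⟩
  · rintro ⟨hst, hmem, hcard⟩
    rw [Finset.card_union_of_disjoint hst] at hcard
    have htc : t.card = k + 1 := by omega
    exact ⟨⟨Finset.card_pos.1 (by omega), hst, hmem⟩, htc⟩

theorem injOn_union_left (s : Finset V) : Set.InjOn (s ∪ ·) {t | Disjoint s t} := by
  intro t ht u hu h
  rw [← Finset.union_sdiff_cancel_left ht, ← Finset.union_sdiff_cancel_left hu]
  exact congrArg (· \ s) h

theorem finite_faces_link (hs : {t | t ∈ K ∧ s ⊆ t}.Finite) : (K.link s).faces.Finite := by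
  refine Set.Finite.of_finite_image (hs.subset ?_)
    ((injOn_union_left s).mono fun t ht => ht.2.1)
  rintro _ ⟨t, ⟨-, -, hmem⟩, rfl⟩
  exact ⟨hmem, Finset.subset_union_left⟩

theorem incidence_link (hst : Disjoint s t) :
    (K.link s).incidence k t = K.incidence (k + s.card) (s ∪ t) := by
  have himage : {u | u ∈ K.simplices (k + s.card) ∧ s ∪ t ⊆ u} =
      (s ∪ ·) '' {u | u ∈ (K.link s).simplices k ∧ t ⊆ u} := by
    ext u
    constructor
    · rintro ⟨hu, hsub⟩
      obtain ⟨hsu, htu⟩ := Finset.union_subset_iff.1 hsub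
      have hunion : s ∪ u \ s = u := Finset.union_sdiff_of_subset hsu
      refine ⟨u \ s, ⟨mem_simplices_link.2 ⟨Finset.disjoint_sdiff, ?_⟩,
        Finset.subset_sdiff.2 ⟨htu, hst.symm⟩⟩, hunion⟩
      rwa [hunion]
    · rintro ⟨w, ⟨hw, htw⟩, rfl⟩
      exact ⟨(mem_simplices_link.1 hw).2, Finset.union_subset_union_right htw⟩
  rw [PreAbstractSimplicialComplex.incidence, PreAbstractSimplicialComplex.incidence, himage,
    Set.InjOn.ncard_image]
  exact (injOn_union_left s).mono fun w hw => (mem_simplices_link.1 hw.1).1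

end Link

section ZeroSphere

variable {V : Type*} [DecidableEq V]

theorem modTwoBoundaries_eq_bot {F : Set (Finset V)} {n : ℕ} (hF : ∀ s ∈ F, s.card ≤ n) :
    modTwoBoundaries F n = ⊥ := by
  have hchains : modTwoChains F (n + 1) = ⊥ := by
    rw [modTwoChains, ← Finsupp.supported_empty]
    congr 1
    exact Set.eq_empty_of_forall_notMem fun s ⟨hs, hcard⟩ => by have := hF s hs; omega
  rw [modTwoBoundaries, hchains, Submodule.map_bot]

theorem exists_eq_zero_or_eq_of_linearEquiv {M : Type*} [AddCommGroup M] [Module (ZMod 2) M]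
    (φ : M ≃ₗ[ZMod 2] ZMod 2) : ∃ z : M, z ≠ 0 ∧ ∀ x : M, x = 0 ∨ x = z := by
  refine ⟨φ.symm 1, by simp, fun x => ?_⟩
  have htwo : ∀ a : ZMod 2, a = 0 ∨ a = 1 := by decide
  rw [LinearEquiv.eq_symm_apply, ← φ.map_eq_zero_iff]
  exact htwo (φ x)

theorem single_add_single_mem_modTwoCycles {F : Set (Finset V)} {s t : Finset V}
    (hs : s ∈ F) (ht : t ∈ F) (hsc : s.card = 1) (htc : t.card = 1) :
    Finsupp.single s 1 + Finsupp.single t 1 ∈ modTwoCycles F 1 := by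
  classical
  refine ⟨add_mem (Finsupp.single_mem_supported _ _ ⟨hs, hsc⟩)
    (Finsupp.single_mem_supported _ _ ⟨ht, htc⟩), LinearMap.mem_ker.2 (Finsupp.ext fun u => ?_)⟩
  rw [map_add, Finsupp.add_apply, modTwoBoundary_single_apply, modTwoBoundary_single_apply,
    hsc, htc]
  by_cases hu : u = ∅
  · simp [hu, CharTwo.add_self_eq_zero]
  · simp [hu]

theorem even_card_support_of_mem_modTwoCycles {F : Set (Finset V)} (hF : ∅ ∈ F)
    {x : Finset V →₀ ZMod 2} (hx : x ∈ modTwoCycles F 1) : Even x.support.card := by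
  classical
  have hempty := DFunLike.congr_fun (LinearMap.mem_ker.1 hx.2) ∅
  rw [modTwoBoundary_apply (n := 0) hx.1, if_pos ⟨hF, Finset.card_empty⟩, Finsupp.zero_apply,
    ZMod.natCast_eq_zero_iff_even] at hempty
  simpa using hempty

theorem ncard_simplices_zero_eq_two {K : PreAbstractSimplicialComplex V}
    (hdim : ∀ s ∈ K, s.card ≤ 1) (hH : Nonempty (K.ReducedHomology 1 ≃ₗ[ZMod 2] ZMod 2)) :
    (K.simplices 0).ncard = 2 := by
  obtain ⟨φ⟩ := hH
  have hbot : (modTwoBoundaries (insert ∅ K.faces) 1).submoduleOf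
      (modTwoCycles (insert ∅ K.faces) 1) = ⊥ := by
    rw [modTwoBoundaries_eq_bot (F := insert ∅ K.faces)
      (Set.forall_mem_insert.2 ⟨Nat.zero_le 1, hdim⟩)]
    exact LinearMap.ker_eq_bot.2 (Submodule.subtype_injective _)
  obtain ⟨⟨z, hz⟩, hz0, hcycle⟩ :=
    exists_eq_zero_or_eq_of_linearEquiv ((Submodule.quotEquivOfEqBot _ hbot).symm ≪≫ₗ φ)
  have hne : z ≠ 0 := fun h => hz0 (Subtype.ext h)
  have hpair : ∀ a ∈ K.simplices 0, ∀ b ∈ K.simplices 0, a ≠ b →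
      Finsupp.single a 1 + Finsupp.single b 1 = z := by
    intro a ha b hb hab
    have hmem := single_add_single_mem_modTwoCycles (Set.mem_insert_of_mem ∅ ha.1)
      (Set.mem_insert_of_mem ∅ hb.1) ha.2 hb.2
    refine ((hcycle ⟨_, hmem⟩).imp (congrArg Subtype.val) (congrArg Subtype.val)).resolve_left
      fun h => ?_
    have := DFunLike.congr_fun h a
    simp [hab] at this
  have hsupp : ∀ a ∈ z.support, a ∈ K.simplices 0 := by
    intro a ha
    obtain ⟨rfl | hmem, hcard⟩ := (Finsupp.mem_supported _ _).1 hz.1 ha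
    · simp at hcard
    · exact ⟨hmem, hcard⟩
  have hone : 1 < z.support.card := by
    have heven := even_card_support_of_mem_modTwoCycles (Set.mem_insert ∅ _) hz
    have hpos := Finset.card_pos.2 (Finsupp.support_nonempty_iff.2 hne)
    grind
  obtain ⟨a, ha, b, hb, hab⟩ := Finset.one_lt_card.1 hone
  refine Set.ncard_eq_two.2 ⟨a, b, hab, Set.Subset.antisymm (fun c hc => ?_) ?_⟩
  · by_contra hcab
    obtain ⟨hca, hcb⟩ := not_or.1 hcab
    have := (hpair a (hsupp a ha) c hc (Ne.symm hca)).trans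
      (hpair a (hsupp a ha) b (hsupp b hb) hab).symm
    exact hcb (Finsupp.single_left_injective one_ne_zero (add_left_cancel this))
  · rintro c (rfl | rfl)
    exacts [hsupp _ ha, hsupp _ hb]

theorem incidence_eq_two_of_isHomologyManifold {K : PreAbstractSimplicialComplex V} {d : ℕ}
    (hK : K.IsHomologyManifold d) {s : Finset V} (hs : s ∈ K) (hcard : s.card = d) :
    K.incidence d s = 2 := by
  have hlink := incidence_link (K := K) (k := 0) (Finset.disjoint_empty_right s)
  rw [zero_add, hcard, Finset.union_empty] at hlink
  have hsphere := (hK.link_sphere s hs).1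
  rw [hcard, Nat.add_sub_cancel_left] at hsphere
  rw [← hlink, ← ncard_simplices_zero_eq_two (K := K.link s) ?_ hsphere]
  · simp [PreAbstractSimplicialComplex.incidence]
  · rintro t ⟨-, hst, ht⟩
    have := hK.card_le _ ht
    rw [Finset.card_union_of_disjoint hst] at this
    omega

end ZeroSphere

section OddFaces

variable {V : Type*} {K : PreAbstractSimplicialComplex V} {n : ℕ}

theorem subset_iff_eq_or_eq {τ σ σ₁ σ₂ ρ : Finset V} (hne : σ₁ ≠ σ₂)
    (hcard : ρ.card = τ.card + 2) (hτσ : τ ⊂ σ) (hτσ₁ : τ ⊂ σ₁) (hτσ₂ : τ ⊂ σ₂)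
    (hσ : σ ≠ ρ) (hσ₁ : σ₁ ⊂ ρ) (hσ₂ : σ₂ ⊂ ρ) : σ ⊆ ρ ↔ σ = σ₁ ∨ σ = σ₂ := by
  classical
  have hIoo : {σ₁, σ₂} = Finset.Ioo τ ρ := by
    refine Finset.eq_of_subset_of_card_le (fun s hs => ?_) ?_
    · obtain rfl | rfl : s = σ₁ ∨ s = σ₂ := by simpa using hs
      exacts [Finset.mem_Ioo.2 ⟨hτσ₁, hσ₁⟩, Finset.mem_Ioo.2 ⟨hτσ₂, hσ₂⟩]
    · rw [Finset.card_Ioo_finset (hτσ₁.trans hσ₁).subset, hcard, Finset.card_pair hne,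
        Nat.add_sub_cancel_left]
      rfl
  have hmem := Finset.ext_iff.1 hIoo σ
  rw [Finset.mem_insert, Finset.mem_singleton, Finset.mem_Ioo] at hmem
  rw [hmem]
  exact ⟨fun h => ⟨hτσ, h.ssubset_of_ne hσ⟩, fun h => h.2.subset⟩

theorem incidence_eq_incidence_succ (hfin : (K.simplices (n + 1)).Finite)
    (hfin' : (K.simplices (n + 2)).Finite) {s : Finset V} (hs : s.card = n + 1)
    (htwo : ∀ e ∈ K.simplices (n + 1), s ⊆ e → K.incidence (n + 2) e = 2) :
    K.incidence (n + 1) s = K.incidence (n + 2) s := by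
  classical
  rw [incidence_eq_card hfin, incidence_eq_card hfin']
  refine Nat.eq_of_mul_eq_mul_right two_pos
    (Finset.card_mul_eq_card_mul (· ⊆ ·) (fun e he => ?_) fun t ht => ?_)
  · obtain ⟨heK, hse⟩ := Finset.mem_filter.1 he
    refine Eq.trans ?_ (htwo e (hfin.mem_toFinset.1 heK) hse)
    rw [incidence_eq_card hfin', Finset.bipartiteAbove, Finset.filter_filter]
    refine congrArg _ (Finset.filter_congr fun t _ => ?_)
    exact ⟨fun h => h.2, fun h => ⟨hse.trans h, h⟩⟩
  · obtain ⟨htK, hst⟩ := Finset.mem_filter.1 ht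
    obtain ⟨htK, htc⟩ := hfin'.mem_toFinset.1 htK
    have hbetween : Finset.bipartiteBelow (· ⊆ ·) {e ∈ hfin.toFinset | s ⊆ e} t =
        Finset.Ioo s t := by
      ext e
      rw [Finset.mem_bipartiteBelow, Finset.mem_filter, hfin.mem_toFinset, Finset.mem_Ioo]
      constructor
      · rintro ⟨⟨he, hse⟩, het⟩
        have hec : e.card = n + 2 := he.2
        exact ⟨hse.lt_of_ne (by rintro rfl; omega), het.lt_of_ne (by rintro rfl; omega)⟩
      · rintro ⟨hse, het⟩
        have hlow := Finset.card_lt_card hse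
        have hupp := Finset.card_lt_card het
        have hec : e.card = n + 1 + 1 := by omega
        exact ⟨⟨⟨mem_of_subset_of_card htK het.le hec, hec⟩, hse.le⟩, het.le⟩
    rw [hbetween, Finset.card_Ioo_finset hst, htc, hs, show n + 2 + 1 - (n + 1) = 2 by omega]
    rfl

variable [DecidableEq V]

/-- Every member of `T` has `k + 2` members of `E` as faces. Counting incidences with `T` and with
`B` gives `2 * #E = (k + 2) * #T` and `#E - 1 + m = (k + 2) * #B` with `m = 0` or `m = 2`, hence
`k + 2` divides `2`. -/
theorem not_forall_even_card_filter_iff_eq {E T B : Finset (Finset V)} {k : ℕ} (hk : 1 ≤ k)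
    (hE : ∀ e ∈ E, e.card = k + 1) (hT : ∀ t ∈ T, t.card = k + 2)
    (hTE : ∀ t ∈ T, t.powersetCard (k + 1) ⊆ E)
    (htwo : ∀ e ∈ E, ({t ∈ T | e ⊆ t} : Finset (Finset V)).card = 2) (hBT : B ⊆ T)
    {e : Finset V} (he : e ∈ E) :
    ¬∀ f ∈ E, (Even ({t ∈ B | f ⊆ t} : Finset (Finset V)).card ↔ f = e) := by
  intro heven
  have hle : ∀ f ∈ E, ({t ∈ B | f ⊆ t} : Finset (Finset V)).card ≤ 2 := fun f hf =>
    (Finset.card_le_card (Finset.filter_subset_filter _ hBT)).trans (htwo f hf).le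
  have hone : ∀ f ∈ E.erase e, ({t ∈ B | f ⊆ t} : Finset (Finset V)).card = 1 := by
    intro f hf
    obtain ⟨hfe, hfE⟩ := Finset.mem_erase.1 hf
    obtain ⟨m, hm⟩ := Nat.not_even_iff_odd.1 (mt (heven f hfE).1 hfe)
    have := hle f hfE
    omega
  have hcountT := sum_card_filter_subset hE hT hTE
  have hcountB := sum_card_filter_subset hE (fun t ht => hT t (hBT ht))
    fun t ht => hTE t (hBT ht)
  rw [Finset.sum_const_nat htwo, Nat.choose_succ_self_right] at hcountT
  rw [← Finset.add_sum_erase _ _ he, Finset.sum_const_nat hone, Finset.card_erase_of_mem he,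
    Nat.choose_succ_self_right] at hcountB
  obtain ⟨m, hm⟩ := (heven e he).2 rfl
  have hm1 : m ≤ 1 := by have := hle e he; omega
  have hpos := Finset.card_pos.2 ⟨e, he⟩
  zify [hpos] at hcountT hcountB hm
  have hdvd : (k + 2 : ℤ) ∣ 2 - 4 * m :=
    ⟨T.card - 2 * B.card, by linear_combination hcountT - 2 * hcountB + 2 * hm⟩
  interval_cases m <;> have := Int.le_of_dvd (by norm_num) ((dvd_abs _ _).2 hdvd) <;>
    norm_num at this <;> omega

theorem fundamentalChain_add_single_mem_modTwoCycles (hfin : (K.simplices (n + 1)).Finite)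
    {e : Finset V} (he : e ∈ K.simplices (n + 1))
    (hodd : ∀ t ∈ K.simplices n, Odd (K.incidence (n + 1) t) ↔ t ⊆ e) :
    K.fundamentalChain (n + 1) + Finsupp.single e 1 ∈
      modTwoCycles (insert ∅ K.faces) (n + 2) := by
  classical
  refine ⟨add_mem (modTwoChains_mono (fun s hs _ => Or.inr hs)
    (fundamentalChain_mem_modTwoChains (n + 1)))
    (Finsupp.single_mem_supported _ _ (mem_insert_empty_faces_and_card_iff.2 he)),
    LinearMap.mem_ker.2 (Finsupp.ext fun t => ?_)⟩
  rw [map_add, Finsupp.add_apply, Finsupp.zero_apply, modTwoBoundary_fundamentalChain_apply hfin,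
    modTwoBoundary_single_apply]
  have hec : e.card = n + 2 := he.2
  by_cases ht : t ∈ K.simplices n
  · rw [if_pos (mem_insert_empty_faces_and_card_iff.2 ht)]
    by_cases hte : t ⊆ e
    · rw [if_pos ⟨Or.inr ht.1, hte, by rw [ht.2, hec]⟩,
        ZMod.natCast_eq_one_iff_odd.2 ((hodd t ht).2 hte), CharTwo.add_self_eq_zero]
    · rw [if_neg fun h => hte h.2.1, add_zero, ZMod.natCast_eq_zero_iff_even,
        ← Nat.not_odd_iff_even, hodd t ht]
      exact hte
  · rw [if_neg (mt mem_insert_empty_faces_and_card_iff.1 ht), if_neg, add_zero]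
    exact fun h => ht (mem_insert_empty_faces_and_card_iff.1 ⟨h.1, by omega⟩)

theorem exists_modTwoBoundary_eq {F : Set (Finset V)} [Subsingleton (ModTwoHomology F n)]
    {x : Finset V →₀ ZMod 2} (hx : x ∈ modTwoCycles F n) :
    ∃ y ∈ modTwoChains F (n + 1), modTwoBoundary F y = x :=
  (Submodule.Quotient.mk_eq_zero ((modTwoBoundaries F n).submoduleOf (modTwoCycles F n))
    (x := (⟨x, hx⟩ : modTwoCycles F n))).1 (Subsingleton.elim _ _)

theorem not_forall_odd_incidence_iff_subset (hfin : (K.simplices (n + 1)).Finite)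
    (hfin' : (K.simplices (n + 2)).Finite) [Subsingleton (K.ReducedHomology (n + 2))]
    (htwo : ∀ e ∈ K.simplices (n + 1), K.incidence (n + 2) e = 2) {e : Finset V}
    (he : e ∈ K.simplices (n + 1)) :
    ¬∀ t ∈ K.simplices n, (Odd (K.incidence (n + 2) t) ↔ t ⊆ e) := by
  classical
  intro hodd
  obtain ⟨y, hy, hboundary⟩ := exists_modTwoBoundary_eq
    (fundamentalChain_add_single_mem_modTwoCycles hfin he fun t ht =>
      incidence_eq_incidence_succ hfin hfin' ht.2 (fun f hf _ => htwo f hf) ▸ hodd t ht)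
  have hsupp : y.support ⊆ hfin'.toFinset := fun t ht =>
    hfin'.mem_toFinset.2
      (mem_insert_empty_faces_and_card_iff.1 ((Finsupp.mem_supported _ _).1 hy ht))
  refine not_forall_even_card_filter_iff_eq (k := n + 1) (E := hfin.toFinset)
    (T := hfin'.toFinset) (B := y.support) (e := e) (by omega)
    (fun f hf => (hfin.mem_toFinset.1 hf).2) (fun t ht => (hfin'.mem_toFinset.1 ht).2)
    (fun t ht f hf => ?_) (fun f hf => ?_) hsupp (hfin.mem_toFinset.2 he) fun f hf => ?_
  · obtain ⟨hft, hfc⟩ := Finset.mem_powersetCard.1 hf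
    exact hfin.mem_toFinset.2
      ⟨mem_of_subset_of_card (hfin'.mem_toFinset.1 ht).1 hft hfc, hfc⟩
  · rw [← incidence_eq_card hfin', htwo f (hfin.mem_toFinset.1 hf)]
  · have hf' := hfin.mem_toFinset.1 hf
    have hcoeff := DFunLike.congr_fun hboundary f
    rw [modTwoBoundary_apply hy, if_pos (mem_insert_empty_faces_and_card_iff.2 hf'),
      Finsupp.add_apply, fundamentalChain_apply hfin, if_pos hf'] at hcoeff
    rw [← ZMod.natCast_eq_zero_iff_even, hcoeff]
    by_cases hfe : f = e
    · simp [hfe, CharTwo.add_self_eq_zero]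
    · simp [hfe]

theorem not_forall_odd_incidence_iff_subset_of_link {τ ρ : Finset V}
    (hstar : {t | t ∈ K ∧ τ ⊆ t}.Finite) [Subsingleton ((K.link τ).ReducedHomology (n + 2))]
    (htwo : ∀ r ∈ K.simplices (n + 1 + τ.card), τ ⊆ r → K.incidence (n + 2 + τ.card) r = 2)
    (hρ : ρ ∈ K.simplices (n + 1 + τ.card)) (hτρ : τ ⊆ ρ) :
    ¬∀ σ ∈ K.simplices (n + τ.card), τ ⊆ σ →
      (Odd (K.incidence (n + 2 + τ.card) σ) ↔ σ ⊆ ρ) := by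
  intro hodd
  have hfin := finite_simplices (finite_faces_link hstar)
  refine not_forall_odd_incidence_iff_subset (e := ρ \ τ) (hfin (n + 1)) (hfin (n + 2))
    (fun e he => ?_) ?_ fun t ht => ?_
  · obtain ⟨hdisj, hmem⟩ := mem_simplices_link.1 he
    rw [incidence_link hdisj, htwo _ hmem Finset.subset_union_left]
  · rw [mem_simplices_link, Finset.union_sdiff_of_subset hτρ]
    exact ⟨Finset.disjoint_sdiff, hρ⟩
  · obtain ⟨hdisj, hmem⟩ := mem_simplices_link.1 ht
    rw [incidence_link hdisj, hodd _ hmem Finset.subset_union_left, Finset.union_subset_iff,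
      Finset.subset_sdiff]
    exact ⟨fun h => ⟨h.2, hdisj.symm⟩, fun h => ⟨hτρ, h.1⟩⟩

theorem not_exists_simplex_of_odd_pair {d : ℕ} (hd : 3 ≤ d) {τ : Finset V}
    (hτ : τ ∈ K.simplices (d - 3)) (hstar : {t | t ∈ K ∧ τ ⊆ t}.Finite)
    [Subsingleton ((K.link τ).ReducedHomology 2)]
    (htwo : ∀ r ∈ K.simplices (d - 1), τ ⊆ r → K.incidence d r = 2) {σ₁ σ₂ : Finset V}
    (hne : σ₁ ≠ σ₂)
    (hpair : {σ | σ ∈ (K.oddSubcomplex d).simplices (d - 2) ∧ τ ⊆ σ} = {σ₁, σ₂}) :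
    ¬∃ ρ ∈ K.simplices (d - 1), σ₁ ⊆ ρ ∧ σ₂ ⊆ ρ := by
  rintro ⟨ρ, hρ, hσ₁ρ, hσ₂ρ⟩
  rw [simplices_oddSubcomplex] at hpair
  have hodd : ∀ σ, ((σ ∈ K.simplices (d - 2) ∧ Odd (K.incidence d σ)) ∧ τ ⊆ σ) ↔
      σ = σ₁ ∨ σ = σ₂ := Set.ext_iff.1 hpair
  have hτcard := hτ.2
  have hρcard := hρ.2
  have hτσ : ∀ σ ∈ K.simplices (d - 2), τ ⊆ σ → τ ⊂ σ := fun σ hσ hτσ =>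
    hτσ.ssubset_of_ne (by rintro rfl; have := hσ.2; omega)
  have hσρ : ∀ σ ∈ K.simplices (d - 2), σ ≠ ρ := by
    rintro σ hσ rfl
    have := hσ.2
    omega
  obtain ⟨⟨hσ₁, -⟩, hτσ₁⟩ := (hodd σ₁).2 (Or.inl rfl)
  obtain ⟨⟨hσ₂, -⟩, hτσ₂⟩ := (hodd σ₂).2 (Or.inr rfl)
  have hlink := not_forall_odd_incidence_iff_subset_of_link (K := K) (n := 0) (ρ := ρ) hstar
  rw [show 0 + 2 + τ.card = d by omega, show 0 + 1 + τ.card = d - 1 by omega,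
    show 0 + τ.card = d - 2 by omega] at hlink
  refine hlink htwo hρ (hτσ₁.trans hσ₁ρ) fun σ hσ hτσ' => ?_
  rw [subset_iff_eq_or_eq hne (by omega) (hτσ σ hσ hτσ') (hτσ σ₁ hσ₁ hτσ₁) (hτσ σ₂ hσ₂ hτσ₂)
    (hσρ σ hσ) (hσ₁ρ.ssubset_of_ne (hσρ σ₁ hσ₁)) (hσ₂ρ.ssubset_of_ne (hσρ σ₂ hσ₂)), ← hodd]
  exact ⟨fun h => ⟨⟨hσ, h⟩, hτσ'⟩, fun h => h.1.2⟩

end OddFaces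

end ModTwoHomology

open ModTwoHomology

theorem mainTheorem5_general {V : Type*} [DecidableEq V] (K : PreAbstractSimplicialComplex V)
    (d : ℕ) (hd : 2 ≤ d) :
    ((K.simplices d).Finite → (∀ r ∈ K.simplices (d - 1), Even (K.incidence d r)) →
      K.OddClassVanishes d) ∧
    ((K.simplices d).Finite →
      (d % 4 = 0 ∨ d % 4 = 3 → Even ((K.oddSubcomplex d).simplices (d - 2)).ncard) ∧
      (d % 4 = 1 ∨ d % 4 = 2 →
        ((K.oddSubcomplex d).simplices (d - 2)).ncard ≡ (K.simplices d).ncard [MOD 2])) ∧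
    (3 ≤ d → ∀ τ ∈ K.simplices (d - 3), {t | t ∈ K ∧ τ ⊆ t}.Finite →
      Subsingleton ((K.link τ).ReducedHomology 2) →
      (∀ r ∈ K.simplices (d - 1), τ ⊆ r → K.incidence d r = 2) →
      ∀ σ₁ σ₂ : Finset V, σ₁ ≠ σ₂ →
        {σ | σ ∈ (K.oddSubcomplex d).simplices (d - 2) ∧ τ ⊆ σ} = {σ₁, σ₂} →
        ¬∃ ρ ∈ K.simplices (d - 1), σ₁ ⊆ ρ ∧ σ₂ ⊆ ρ) :=
  ⟨oddClassVanishes_of_forall_even hd, ncard_simplices_oddSubcomplex_parity hd,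
    fun hd3 _ hτ hstar _ htwo _ _ => not_exists_simplex_of_odd_pair hd3 hτ hstar htwo⟩

theorem mainTheorem5 {V : Type*} [DecidableEq V] (K : PreAbstractSimplicialComplex V) (d : ℕ)
    (hd : 2 ≤ d) :
    -- (1) the odd subcomplex is a boundary mod 2, for closed triangulated manifolds and, more
    -- generally, for finite complexes whose `d`-simplices sum up to a mod 2 cycle
    (K.faces.Finite → K.IsHomologyManifold d → K.OddClassVanishes d) ∧
    (K.faces.Finite → (∀ r ∈ K.simplices (d - 1), Even (K.incidence d r)) →
      K.OddClassVanishes d) ∧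
    -- (2) parity of the number of `(d - 2)`-faces of the odd subcomplex
    (K.faces.Finite →
      (d % 4 = 0 ∨ d % 4 = 3 → Even ((K.oddSubcomplex d).simplices (d - 2)).ncard) ∧
      (d % 4 = 1 ∨ d % 4 = 2 →
        ((K.oddSubcomplex d).simplices (d - 2)).ncard ≡ (K.simplices d).ncard [MOD 2])) ∧
    -- (3) two odd faces that are the only ones around a `(d - 3)`-face
    (3 ≤ d → K.IsHomologyManifold d →
      ∀ τ ∈ K.simplices (d - 3), ∀ σ₁ σ₂ : Finset V, σ₁ ≠ σ₂ →
        {σ | σ ∈ (K.oddSubcomplex d).simplices (d - 2) ∧ τ ⊆ σ} = {σ₁, σ₂} →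
        ¬ ∃ ρ ∈ K.simplices (d - 1), σ₁ ⊆ ρ ∧ σ₂ ⊆ ρ) := by
  obtain ⟨hzero, hparity, hpair⟩ := mainTheorem5_general K d hd
  have htwo (hK : K.IsHomologyManifold d) (r) (hr : r ∈ K.simplices (d - 1)) :
      K.incidence d r = 2 :=
    incidence_eq_two_of_isHomologyManifold hK hr.1 (hr.2.trans (by omega))
  refine ⟨fun hfin hK => hzero (finite_simplices hfin d) fun r hr => htwo hK r hr ▸ even_two,
    fun hfin => hzero (finite_simplices hfin d), fun hfin => hparity (finite_simplices hfin d),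
    fun hd3 hK τ hτ => hpair hd3 τ hτ (hK.locallyFinite τ hτ.1)
      ((hK.link_sphere τ hτ.1).2 2 ?_) fun r hr _ => htwo hK r hr⟩
  have := hτ.2
  omega
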